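/- Let $\lambda_l,\lambda_e\ge 0$, $p\in[0,1]$ and $\eta,\beta_l,\beta_e>0$. Let $\Phi_l$ (legitimate nodes) and $\Phi_e$ (eavesdroppers) be independent homogeneous Poisson point processes in $\mathbb{R}^2$ with densities $\lambda_l$ and $\lambda_e$. In a given time slot each node of $\Phi_l$ transmits with probability $p$, independently of the other nodes, of all positions and of $\Phi_e$; let $\Phi_t\subseteq\Phi_l$ be the set of transmitting nodes and $\Phi_r=\Phi_l\setminus\Phi_t$ the set of receiving nodes. A transmitter $x$ can securely connect to a receiver $y$ if (C1) $\|x-y\|_2<\eta$; (C2) the disk of radius $\beta_l\|x-y\|_2$ centred at $y$ contains no transmitter other than $x$; and (C3) the disk of radius $\beta_e\|x-y\|_2$ centred at $x$ contains no point of $\Phi_e$. Let $N_{r,0}$ be the number of transmitters in $\Phi_t$ that can securely connect to a receiver placed at the origin (a typical receiver), and let $N_{t,0}$ be the number of receivers in $\Phi_r$ to which a transmitter placed at the origin can securely connect. Then $$\mathbb{E} N_{r,0}=\frac{\lambda_l p\,\bigl[1-\exp\bigl(-(\lambda_l p\beta_l^2+\lambda_e\beta_e^2)\pi\eta^2\bigr)\bigr]}{\lambda_l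 p\beta_l^2+\lambda_e\beta_e^2},$$ where the right-hand side is read as $0$ if $\lambda_l p=\lambda_e=0$. Moreover, if $p<1$, then $$\mathbb{E}N_{r,0}=\frac{p}{1-p}\,\mathbb{E}N_{t,0}.$$ -/

import Mathlib

open MeasureTheory ProbabilityTheory
open scoped NNReal ENNReal

noncomputable section

/-- The Euclidean plane. -/
abbrev Plane : Type := EuclideanSpace ℝ (Fin 2)

section PointProcess

variable {Ω : Type*}

/-- The number of points of the random set `Φ` in the region `B`. -/
def count (Φ : Ω → Set Plane) (B : Set Plane) (ω : Ω) : ℕ∞ := (Φ ω ∩ B).encard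

/-- The σ-algebra on `Ω` generated by a random set, that is, by all its counts in Borel sets. -/
@[reducible] def sigmaOf (Φ : Ω → Set Plane) : MeasurableSpace Ω :=
  ⨆ (B : Set Plane) (_ : MeasurableSet B), MeasurableSpace.comap (count Φ B) inferInstance

/-- `Φ` is a homogeneous Poisson point process of density `lam` on the plane. -/
structure IsPoissonProcess [MeasurableSpace Ω] (P : Measure Ω) (Φ : Ω → Set Plane)
    (lam : ℝ≥0) : Prop where
  measurable_count : ∀ B, MeasurableSet B → Measurable (count Φ B)
  locallyFinite : ∀ᵐ ω ∂P, ∀ B, Bornology.IsBounded B → (Φ ω ∩ B).Finite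
  law_count : ∀ B, MeasurableSet B → Bornology.IsBounded B →
    P.map (count Φ B) =
      (poissonMeasure (lam * (volume B).toNNReal)).map (fun n : ℕ => (n : ℕ∞))
  indep_count : ∀ (n : ℕ) (B : Fin n → Set Plane), (∀ i, MeasurableSet (B i)) →
    Pairwise (Function.onFun Disjoint B) → iIndepFun (fun i => count Φ (B i)) P

end PointProcess

/-- The random data of the network in one time slot: the legitimate nodes are enumerated as
`node i` for `i < num` (their number may be infinite), `tx i` tells whether node `i` transmits,
and `eves` is the set of eavesdroppers. -/
structure Network (Ω : Type*) where
  num : Ω → ℕ∞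
  node : ℕ → Ω → Plane
  tx : ℕ → Ω → Bool
  eves : Ω → Set Plane

namespace Network

variable {Ω : Type*} (N : Network Ω)

/-- The legitimate nodes. -/
def legit (ω : Ω) : Set Plane := {x | ∃ i : ℕ, (i : ℕ∞) < N.num ω ∧ N.node i ω = x}

/-- The transmitting nodes. -/
def transmitters (ω : Ω) : Set Plane :=
  {x | ∃ i : ℕ, (i : ℕ∞) < N.num ω ∧ N.tx i ω = true ∧ N.node i ω = x}

/-- The receiving nodes: all legitimate nodes that do not transmit (half-duplex). -/
def receivers (ω : Ω) : Set Plane := N.legit ω \ N.transmitters ω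

/-- The stochastic model: legitimate nodes and eavesdroppers form independent Poisson processes
of densities `lamL` and `lamE`, and every legitimate node transmits with probability `p`,
independently of the other nodes, of all positions and of the eavesdroppers (slotted ALOHA). -/
structure IsAlohaModel [MeasurableSpace Ω] (P : Measure Ω) (lamL lamE : ℝ≥0) (p : ℝ) :
    Prop where
  measurable_num : Measurable N.num
  measurable_node : ∀ i, Measurable (N.node i)
  measurable_tx : ∀ i, Measurable (N.tx i)
  /-- no node is listed twice -/
  node_injOn : ∀ᵐ ω ∂P, Set.InjOn (fun i => N.node i ω) {i : ℕ | (i : ℕ∞) < N.num ω}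
  poisson_legit : IsPoissonProcess P N.legit lamL
  poisson_eves : IsPoissonProcess P N.eves lamE
  prob_tx : ∀ i, P {ω | N.tx i ω = true} = ENNReal.ofReal p
  indep_tx : iIndepFun N.tx P
  indep_node_tx :
    IndepFun (fun ω => (N.num ω, fun i => N.node i ω)) (fun ω i => N.tx i ω) P
  indep_eves :
    Indep (MeasurableSpace.comap
      (fun ω => ((N.num ω, fun i => N.node i ω), fun i => N.tx i ω)) inferInstance)
      (sigmaOf N.eves) P

end Network

/-- The transmitter `x` can securely connect to the receiver `y`, when `T`, `R`, `E` are the sets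
of transmitters, receivers and eavesdroppers. -/
structure SecureEdge (η βl βe : ℝ) (T R E : Set Plane) (x y : Plane) : Prop where
  mem_T : x ∈ T
  mem_R : y ∈ R
  close : ‖x - y‖ < η
  /-- no transmitter other than `x` itself is within `βl * ‖x - y‖` of the receiver -/
  no_interferer : ∀ z ∈ T, z ≠ x → z ∉ Metric.ball y (βl * ‖x - y‖)
  no_eavesdropper : ∀ z ∈ E, z ∉ Metric.ball x (βe * ‖x - y‖)

/-- Secure in-degree of a receiver placed at the origin. -/
def Network.inDegree {Ω : Type*} (N : Network Ω) (η βl βe : ℝ) (ω : Ω) : ℕ∞ :=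
  {x | SecureEdge η βl βe (N.transmitters ω) (insert 0 (N.receivers ω)) (N.eves ω) x 0}.encard

/-- Secure out-degree of a transmitter placed at the origin. -/
def Network.outDegree {Ω : Type*} (N : Network Ω) (η βl βe : ℝ) (ω : Ω) : ℕ∞ :=
  {y | SecureEdge η βl βe (insert 0 (N.transmitters ω)) (N.receivers ω) (N.eves ω) 0 y}.encard

end

/-! Each degree is almost surely a countable sum of indicators of events "node `i` forms a secure
link" (`linkEvent`), so its mean is the sum of their probabilities. Each probability is averaged in
stages. Eavesdroppers are independent of everything else, and their void probability gives the
factor exp(-λ_e π β_e² |x|²). For fixed positions, the modes are independent: the node has the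
required mode with probability p or 1 - p, and every other node in the exclusion disk contributes a
factor q = 1 - p. No thinning theorem is needed.

There remains the mean of a sum over Poisson points x of a weight g(x) times q to the number of
other points in a disk attached to x. This is a Mecke formula (`lintegral_tsum_mul_pow_ncard`),
derived from the laws and independence of counts alone. The plane is cut into small cells. The event
that a cell C has exactly one point is independent of the count in a disk outside C, and the product
of the two means is λ|C| exp(-λ|C|) times the generating function exp(-(1 - q)λ|A \ C|). As the
cells shrink, both sides converge by dominated convergence.

Since 1 - q = p, the integrand is exp(-π(λ_l p β_l² + λ_e β_e²)|x|²), a Gaussian over the disk of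
radius η. Moving the centres of the disks from the origin to the node does not change their areas,
so the two degrees share this integral and their means differ only in the mode factor, p against 1 -
p. -/

/-! ### The Poisson law. -/

/-- Lower Lebesgue integrals against the Poisson law. -/
theorem lintegral_poissonMeasure (r : ℝ≥0) (f : ℕ → ℝ≥0∞) :
    ∫⁻ n, f n ∂(poissonMeasure r) =
      ∑' n : ℕ, f n * ENNReal.ofReal (Real.exp (-r) * r ^ n / n.factorial) := by
  rw [lintegral_countable']
  simp_rw [poissonMeasure_singleton]

/-- The probability generating function of the Poisson law. -/
theorem lintegral_pow_poissonMeasure (r q : ℝ≥0) :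
    ∫⁻ n, (q : ℝ≥0∞) ^ n ∂(poissonMeasure r) = ENNReal.ofReal (Real.exp (-((1 - q) * r))) := by
  rw [lintegral_poissonMeasure]
  have h : HasSum (fun n : ℕ => Real.exp (-r) * ((q * r : ℝ) ^ n / n.factorial))
      (Real.exp (-r) * Real.exp (q * r)) := by
    have := NormedSpace.expSeries_div_hasSum_exp (q * r : ℝ)
    rw [← Real.exp_eq_exp_ℝ] at this
    exact this.mul_left _
  rw [show -((1 - (q : ℝ)) * r) = -r + q * r by ring, Real.exp_add, ← h.tsum_eq,
    ENNReal.ofReal_tsum_of_nonneg (fun n => by positivity) h.summable]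
  refine tsum_congr fun n => ?_
  rw [← ENNReal.ofReal_coe_nnreal, ← ENNReal.ofReal_pow q.coe_nonneg,
    ← ENNReal.ofReal_mul (by positivity)]
  congr 1
  rw [mul_pow]; ring

/-- The mean of the Poisson law is finite. -/
theorem lintegral_natCast_poissonMeasure_ne_top (r : ℝ≥0) :
    ∫⁻ n, (n : ℝ≥0∞) ∂(poissonMeasure r) ≠ ∞ := by
  -- Since n ≤ 2^n, the generating function at 2 bounds the mean.
  have hle : ∀ n : ℕ, (n : ℝ≥0∞) ≤ ((2 : ℝ≥0) : ℝ≥0∞) ^ n := fun n => by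
    exact_mod_cast n.lt_two_pow_self.le
  refine ne_top_of_le_ne_top ?_ (lintegral_mono hle)
  rw [lintegral_pow_poissonMeasure]
  exact ENNReal.ofReal_ne_top

/-! ### Laws and independence of counts. -/

namespace IsPoissonProcess

variable {Ω : Type*} [MeasurableSpace Ω] {P : Measure Ω} {Φ : Ω → Set Plane} {lam : ℝ≥0}
  {A B : Set Plane}

theorem lintegral_count (h : IsPoissonProcess P Φ lam) (hB : MeasurableSet B)
    (hb : Bornology.IsBounded B) (f : ℕ∞ → ℝ≥0∞) :
    ∫⁻ ω, f (count Φ B ω) ∂P =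
      ∫⁻ n : ℕ, f n ∂(poissonMeasure (lam * (volume B).toNNReal)) := by
  rw [← lintegral_map (f := f) .of_discrete (h.measurable_count B hB), h.law_count B hB hb,
    lintegral_map .of_discrete .of_discrete]

theorem lintegral_pow_count (h : IsPoissonProcess P Φ lam) (hB : MeasurableSet B)
    (hb : Bornology.IsBounded B) (q : ℝ≥0) :
    ∫⁻ ω, (q : ℝ≥0∞) ^ (count Φ B ω).toNat ∂P =
      ENNReal.ofReal (Real.exp (-((1 - q) * (lam * volume.real B)))) := by
  rw [h.lintegral_count hB hb (fun n => (q : ℝ≥0∞) ^ n.toNat)]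
  simp only [ENat.toNat_natCast]
  rw [lintegral_pow_poissonMeasure]
  rfl

theorem measure_count_eq (h : IsPoissonProcess P Φ lam) (hB : MeasurableSet B)
    (hb : Bornology.IsBounded B) (k : ℕ) :
    P {ω | count Φ B ω = k} = ENNReal.ofReal
      (Real.exp (-(lam * volume.real B)) * (lam * volume.real B) ^ k / k.factorial) := by
  have h1 : P {ω | count Φ B ω = k} = P.map (count Φ B) {(k : ℕ∞)} := by
    rw [Measure.map_apply (h.measurable_count B hB) (MeasurableSet.singleton _)]; rfl
  rw [h1, h.law_count B hB hb, Measure.map_apply .of_discrete (MeasurableSet.singleton _)]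
  have h2 : (fun n : ℕ => (n : ℕ∞)) ⁻¹' {(k : ℕ∞)} = {k} := by ext n; simp
  rw [h2, poissonMeasure_singleton]
  rfl

theorem lintegral_count_ne_top (h : IsPoissonProcess P Φ lam) (hB : MeasurableSet B)
    (hb : Bornology.IsBounded B) : ∫⁻ ω, (count Φ B ω : ℝ≥0∞) ∂P ≠ ∞ := by
  rw [h.lintegral_count hB hb (fun n => (n : ℝ≥0∞))]
  simpa using lintegral_natCast_poissonMeasure_ne_top _

theorem indepFun_count (h : IsPoissonProcess P Φ lam) (hA : MeasurableSet A)
    (hB : MeasurableSet B) (hAB : Disjoint A B) : IndepFun (count Φ A) (count Φ B) P := by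
  have := h.indep_count 2 ![A, B] (by simp [Fin.forall_fin_two, hA, hB])
    (by
      intro i j hij
      fin_cases i <;> fin_cases j <;> simp_all [Function.onFun, hAB.symm])
  simpa using this.indepFun (i := 0) (j := 1) (by decide)

end IsPoissonProcess

/-! ### Partition of the plane into small measurable cells. -/

section Cells

open Metric Filter Topology

/-- In a separable space, every point can be measurably assigned a term of a dense sequence that
is `δ`-close to it. -/
theorem exists_measurable_dist_denseSeq_lt {X : Type*} [PseudoMetricSpace X]
    [TopologicalSpace.SeparableSpace X] [Nonempty X] [MeasurableSpace X] [OpensMeasurableSpace X]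
    {δ : ℝ} (hδ : 0 < δ) :
    ∃ κ : X → ℕ, Measurable κ ∧ ∀ x, dist x (TopologicalSpace.denseSeq X (κ x)) < δ := by
  classical
  have hp : ∀ x : X, ∃ k, dist x (TopologicalSpace.denseSeq X k) < δ := fun x => by
    exact (TopologicalSpace.denseRange_denseSeq X).exists_dist_lt x hδ
  exact ⟨fun x => Nat.find (hp x), measurable_find hp fun k => measurableSet_ball,
    fun x => Nat.find_spec (hp x)⟩

/-- A sum over the cells that contain exactly one point of `T` is a sum over the points of `T`
that are alone in their cell. -/
theorem tsum_indicator_singleton_fiber {α ι : Type*} (T : Set α) (κ : α → ι) (h : ι → ℝ≥0∞) :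
    ∑' k, Set.indicator {1} 1 (T ∩ κ ⁻¹' {k}).encard * h k =
      ∑' x : T, Set.indicator {1} 1 (T ∩ κ ⁻¹' {κ x}).encard * h (κ x) := by
  rw [← ENNReal.tsum_fiberwise _ (fun x : T => κ x)]
  refine tsum_congr fun k => ?_
  have h1 : ∀ x : ((fun x : T => κ x) ⁻¹' {k}),
      Set.indicator {1} 1 (T ∩ κ ⁻¹' {κ x}).encard * h (κ x) =
        Set.indicator {1} (1 : ℕ∞ → ℝ≥0∞) (T ∩ κ ⁻¹' {k}).encard * h k := fun x => by
    have : κ x = k := x.2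
    rw [this]
  rw [tsum_congr h1, ENNReal.tsum_set_const]
  have h2 : ((fun x : T => κ x) ⁻¹' {k}).encard = (T ∩ κ ⁻¹' {k}).encard := by
    rw [← Subtype.val_injective.encard_image]
    congr 1
    ext x
    simp [and_comm]
  rw [h2]
  -- The constant sum over a fibre brings in its cardinality as a factor; the indicator makes that
  -- factor 1 or irrelevant.
  by_cases h3 : (T ∩ κ ⁻¹' {k}).encard = 1 <;> simp [h3]

/-- The truncation `max r 0` is needed because radii shrunk by a margin can be negative. -/
theorem volume_real_ball (x : Plane) (r : ℝ) :
    volume.real (ball x r) = max r 0 ^ 2 * Real.pi := by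
  rw [measureReal_def, EuclideanSpace.volume_ball_fin_two, ENNReal.toReal_mul, ENNReal.toReal_pow,
    ENNReal.toReal_ofReal', ENNReal.toReal_ofReal Real.pi_pos.le]

end Cells

/-! ### Limits along shrinking cells for a fixed locally finite configuration. -/

section Configuration

open Metric Filter Topology

variable {S B : Set Plane} {x : Plane} {κ : ℕ → Plane → ℕ} {c : ℕ → Plane} {δ : ℕ → ℝ}

/-- A point of a finite set is eventually alone in its cell. -/
theorem eventually_inter_cell_eq_singleton (hδ : Tendsto δ atTop (𝓝 0))
    (hκ : ∀ n y, dist y (c (κ n y)) < δ n) (hS : S.Finite) (hx : x ∈ S) :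
    ∀ᶠ n in atTop, S ∩ κ n ⁻¹' {κ n x} = {x} := by
  have h : ∀ᶠ n in atTop, ∀ z ∈ S, z ≠ x → κ n z ≠ κ n x := by
    rw [eventually_all_finite hS]
    intro z _
    by_cases hz : z = x
    · simp [hz]
    -- Two points of one cell are both δ-close to its centre, hence less than 2δ apart.
    have h2 : Tendsto (fun n => 2 * δ n) atTop (𝓝 0) := by simpa using hδ.const_mul 2
    filter_upwards [h2.eventually_lt_const (dist_pos.2 hz)] with n hn _ he
    have h3 := hκ n z
    have h4 := hκ n x
    rw [he] at h3
    linarith [dist_triangle_right z x (c (κ n x))]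
  filter_upwards [h] with n hn
  ext z
  simp only [Set.mem_inter_iff, Set.mem_preimage, Set.mem_singleton_iff]
  constructor
  · rintro ⟨hz, he⟩
    by_contra hne
    exact hn z hz hne he
  · rintro rfl
    exact ⟨hx, rfl⟩

variable {a : Plane → Plane} {r : Plane → ℝ} {K : ℝ≥0}

/-- The ball attached to a cell centre, shrunk by the margin, lies in the ball attached to
any point of the cell. -/
theorem ball_sub_subset_ball (ha : LipschitzWith K a) (hr : LipschitzWith K r) {y x : Plane}
    {ε : ℝ} (h : dist x y < ε) : ball (a y) (r y - 2 * K * ε) ⊆ ball (a x) (r x) := by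
  have h1 := ha.dist_le_mul x y
  have h2 := hr.dist_le_mul x y
  have h3 : (K : ℝ) * dist x y ≤ K * ε := by gcongr
  have h4 := (abs_le.1 (Real.dist_eq (r x) (r y) ▸ h2)).1
  -- Centre and radius each move by at most `K * ε`, which accounts for the margin `2 * K * ε`.
  refine ball_subset_ball' ?_
  rw [dist_comm]
  linarith

theorem tendsto_cell_center (hδ : Tendsto δ atTop (𝓝 0))
    (hκ : ∀ n y, dist y (c (κ n y)) < δ n) (x : Plane) :
    Tendsto (fun n => c (κ n x)) atTop (𝓝 x) := by
  rw [tendsto_iff_dist_tendsto_zero]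
  refine squeeze_zero (fun _ => dist_nonneg) (fun n => ?_) hδ
  rw [dist_comm]
  exact (hκ n x).le

theorem tendsto_cell_radius (hr : LipschitzWith K r) (hδ : Tendsto δ atTop (𝓝 0))
    (hκ : ∀ n y, dist y (c (κ n y)) < δ n) (x : Plane) :
    Tendsto (fun n => r (c (κ n x)) - 2 * K * δ n) atTop (𝓝 (r x)) := by
  have h1 := (hr.continuous.tendsto x).comp (tendsto_cell_center hδ hκ x)
  simpa using h1.sub (hδ.const_mul (2 * (K : ℝ)))

/-- The points in the shrunk ball of the cell of `x` that lie outside the cell are eventually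
the points of the ball of `x` other than `x`. -/
theorem eventually_inter_ball_diff_cell (ha : LipschitzWith K a) (hr : LipschitzWith K r)
    (hδ : Tendsto δ atTop (𝓝 0)) (hκ : ∀ n y, dist y (c (κ n y)) < δ n)
    (hS : ∀ A, Bornology.IsBounded A → (S ∩ A).Finite) (hB : Bornology.IsBounded B)
    (hx : x ∈ S ∩ B) :
    ∀ᶠ n in atTop, S ∩ (ball (a (c (κ n x))) (r (c (κ n x)) - 2 * K * δ n) \
      (B ∩ κ n ⁻¹' {κ n x})) = (S ∩ ball (a x) (r x)) \ {x} := by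
  have h1 := eventually_inter_cell_eq_singleton hδ hκ (hS B hB) hx
  -- Membership in the open limit ball is a strict inequality, so it persists for large n,
  -- simultaneously for the finitely many points.
  have h2 : ∀ᶠ n in atTop, ∀ z ∈ S ∩ ball (a x) (r x),
      z ∈ ball (a (c (κ n x))) (r (c (κ n x)) - 2 * K * δ n) := by
    rw [eventually_all_finite (hS _ isBounded_ball)]
    intro z hz
    have h3 : Tendsto (fun n => dist z (a (c (κ n x)))) atTop (𝓝 (dist z (a x))) :=
      tendsto_const_nhds.dist ((ha.continuous.tendsto x).comp (tendsto_cell_center hδ hκ x))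
    exact h3.eventually_lt (tendsto_cell_radius hr hδ hκ x) hz.2
  filter_upwards [h1, h2] with n hn1 hn2
  have h3 : ∀ z, z ∈ S → (z ∈ B ∩ κ n ⁻¹' {κ n x} ↔ z = x) := fun z hz => by
    have := Set.ext_iff.1 hn1 z
    simp only [Set.mem_inter_iff, Set.mem_singleton_iff] at this ⊢
    tauto
  ext z
  constructor
  · rintro ⟨hz, hzb, hzc⟩
    exact ⟨⟨hz, ball_sub_subset_ball ha hr (hκ n x) hzb⟩, fun h => hzc ((h3 z hz).2 h)⟩
  · rintro ⟨hz, hne⟩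
    exact ⟨hz.1, hn2 z hz, fun h => hne ((h3 z hz.1).1 h)⟩

theorem tendsto_volume_real_cell (hδ : Tendsto δ atTop (𝓝 0))
    (hκ : ∀ n y, dist y (c (κ n y)) < δ n) (B : Set Plane) (x : Plane) :
    Tendsto (fun n => volume.real (B ∩ κ n ⁻¹' {κ n x})) atTop (𝓝 0) := by
  have h1 : Tendsto (fun n => max (δ n) 0 ^ 2 * Real.pi) atTop (𝓝 0) := by
    simpa using ((hδ.max (tendsto_const_nhds (x := (0 : ℝ)))).pow 2).mul_const Real.pi
  refine squeeze_zero (fun _ => measureReal_nonneg) (fun n => ?_) h1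
  rw [← volume_real_ball (c (κ n x))]
  refine measureReal_mono ?_ measure_ball_lt_top.ne
  rintro y ⟨_, hy⟩
  have := hκ n y
  rwa [show κ n y = κ n x from hy] at this

/-- Removing the cell costs at most its area, which vanishes, while the area of the shrunk ball is
continuous in the radius. -/
theorem tendsto_volume_real_ball_diff_cell (hr : LipschitzWith K r)
    (hδ : Tendsto δ atTop (𝓝 0)) (hκ : ∀ n y, dist y (c (κ n y)) < δ n)
    (B : Set Plane) (x : Plane) :
    Tendsto (fun n => volume.real (ball (a (c (κ n x))) (r (c (κ n x)) - 2 * K * δ n) \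
      (B ∩ κ n ⁻¹' {κ n x}))) atTop (𝓝 (volume.real (ball (a x) (r x)))) := by
  have h1 : Tendsto (fun n => volume.real (ball (a (c (κ n x)))
      (r (c (κ n x)) - 2 * K * δ n))) atTop (𝓝 (volume.real (ball (a x) (r x)))) := by
    simp_rw [volume_real_ball]
    exact (((tendsto_cell_radius hr hδ hκ x).max tendsto_const_nhds).pow 2).mul_const _
  have h2 := h1.sub (tendsto_volume_real_cell hδ hκ B x)
  rw [sub_zero] at h2
  refine tendsto_of_tendsto_of_tendsto_of_le_of_le h2 h1 (fun n => ?_) (fun n => ?_)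
  · have hfin : volume (B ∩ κ n ⁻¹' {κ n x}) ≠ ∞ := by
      refine ne_top_of_le_ne_top (measure_ball_lt_top (x := c (κ n x)) (r := δ n)).ne
        (measure_mono ?_)
      rintro y ⟨_, hy⟩
      have := hκ n y
      rwa [show κ n y = κ n x from hy] at this
    exact le_measureReal_sdiff hfin
  · exact measureReal_mono Set.sdiff_subset measure_ball_lt_top.ne

end Configuration

/-! ### The Mecke formula. -/

namespace IsPoissonProcess

open Metric Filter Topology

variable {Ω : Type*} [MeasurableSpace Ω] {P : Measure Ω} {Φ : Ω → Set Plane} {lam : ℝ≥0}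

/-- The region `C` has exactly one point, and every point in `A` outside `C` is weighted
by `q`. -/
theorem lintegral_indicator_count_mul_pow (h : IsPoissonProcess P Φ lam) {A C : Set Plane}
    (hA : MeasurableSet A) (hAb : Bornology.IsBounded A) (hC : MeasurableSet C)
    (hCb : Bornology.IsBounded C) (q : ℝ≥0) :
    ∫⁻ ω, Set.indicator {1} 1 (count Φ C ω) * (q : ℝ≥0∞) ^ (count Φ (A \ C) ω).toNat ∂P =
      lam * (volume C * (ENNReal.ofReal (Real.exp (-(lam * volume.real C))) *
        ENNReal.ofReal (Real.exp (-((1 - q) * (lam * volume.real (A \ C))))))) := by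
  have hAC : MeasurableSet (A \ C) := hA.diff hC
  have hind := (h.indepFun_count hC hAC Set.disjoint_sdiff_right).comp
    (φ := Set.indicator {1} (1 : ℕ∞ → ℝ≥0∞)) (ψ := fun n => (q : ℝ≥0∞) ^ n.toNat)
    .of_discrete .of_discrete
  have hmC : Measurable fun ω => Set.indicator {1} (1 : ℕ∞ → ℝ≥0∞) (count Φ C ω) :=
    (Measurable.of_discrete (f := Set.indicator {1} (1 : ℕ∞ → ℝ≥0∞))).comp
      (h.measurable_count C hC)
  have hmA : Measurable fun ω => (q : ℝ≥0∞) ^ (count Φ (A \ C) ω).toNat :=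
    (Measurable.of_discrete (f := fun n : ℕ∞ => (q : ℝ≥0∞) ^ n.toNat)).comp
      (h.measurable_count _ hAC)
  have h1 := lintegral_mul_eq_lintegral_mul_lintegral_of_indepFun hmC hmA hind
  simp only [Pi.mul_apply] at h1
  rw [h1, h.lintegral_pow_count hAC (hAb.subset Set.sdiff_subset)]
  have h2 : ∫⁻ ω, Set.indicator {1} (1 : ℕ∞ → ℝ≥0∞) (count Φ C ω) ∂P =
      P {ω | count Φ C ω = (1 : ℕ)} := by
    rw [← lintegral_indicator_one
      (measurableSet_eq_fun (h.measurable_count C hC) measurable_const)]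
    refine lintegral_congr fun ω => ?_
    simp [Set.indicator]
  rw [h2, h.measure_count_eq hC hCb]
  have h3 : volume C = ENNReal.ofReal (volume.real C) :=
    (ENNReal.ofReal_toReal hCb.measure_lt_top.ne).symm
  have h4 : Real.exp (-(lam * volume.real C)) * (lam * volume.real C) ^ 1 /
      ((1 : ℕ).factorial : ℝ) =
      lam * (volume.real C * Real.exp (-(lam * volume.real C))) := by
    rw [pow_one, Nat.factorial_one, Nat.cast_one, div_one]
    ring
  rw [h4, h3, ENNReal.ofReal_mul lam.coe_nonneg, ENNReal.ofReal_mul measureReal_nonneg,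
    ENNReal.ofReal_coe_nnreal, mul_assoc, mul_assoc]

/-- A Mecke formula: the sum over the points `x` of a Poisson process in a bounded region `B`
of a continuous weight, times a factor `q` for every other point in a ball attached to `x`. -/
theorem lintegral_tsum_mul_pow_ncard (h : IsPoissonProcess P Φ lam)
    {B : Set Plane} (hB : MeasurableSet B) (hBb : Bornology.IsBounded B)
    {a : Plane → Plane} {r : Plane → ℝ} {K : ℝ≥0}
    (ha : LipschitzWith K a) (hr : LipschitzWith K r)
    {g : Plane → ℝ≥0∞} (hg : Continuous g) (hg1 : ∀ x, g x ≤ 1) {q : ℝ≥0} (hq : q ≤ 1) :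
    ∫⁻ ω, ∑' x : ↥(Φ ω ∩ B), g x * (q : ℝ≥0∞) ^ ((Φ ω ∩ ball (a x) (r x)) \ {x.1}).ncard ∂P =
      lam * ∫⁻ x in B, g x *
        ENNReal.ofReal (Real.exp (-((1 - q) * (lam * volume.real (ball (a x) (r x)))))) := by
  set δ : ℕ → ℝ := fun n => 1 / ((n : ℝ) + 1) with hδdef
  have hδ : Tendsto δ atTop (𝓝 0) := tendsto_one_div_add_atTop_nhds_zero_nat
  set c := TopologicalSpace.denseSeq Plane
  choose κ hκm hκ using fun n => exists_measurable_dist_denseSeq_lt (X := Plane) (δ := δ n)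
    (by positivity)
  have hq' : (q : ℝ≥0∞) ≤ 1 := by exact_mod_cast hq
  let C : ℕ → ℕ → Set Plane := fun n k => B ∩ κ n ⁻¹' {k}
  -- Shrinking keeps the cell's ball inside the ball of every point of the cell. Without it, points
  -- on the limiting sphere could be counted for infinitely many n.
  let A : ℕ → ℕ → Set Plane := fun n k => ball (a (c k)) (r (c k) - 2 * K * δ n)
  have hC : ∀ n k, MeasurableSet (C n k) := fun n k =>
    hB.inter (hκm n (MeasurableSet.singleton k))
  have hCb : ∀ n k, Bornology.IsBounded (C n k) := fun n k => hBb.subset Set.inter_subset_left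
  have hA : ∀ n k, MeasurableSet (A n k) := fun n k => measurableSet_ball
  have hAb : ∀ n k, Bornology.IsBounded (A n k) := fun n k => isBounded_ball
  let w : ℕ → ℕ → Ω → ℝ≥0∞ := fun n k ω =>
    Set.indicator {1} 1 (count Φ (C n k) ω) * (q : ℝ≥0∞) ^ (count Φ (A n k \ C n k) ω).toNat
  have hw : ∀ n k, Measurable (w n k) := fun n k =>
    ((Measurable.of_discrete (f := Set.indicator {1} (1 : ℕ∞ → ℝ≥0∞))).comp
      (h.measurable_count _ (hC n k))).mul
    ((Measurable.of_discrete (f := fun m : ℕ∞ => (q : ℝ≥0∞) ^ m.toNat)).comp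
      (h.measurable_count _ ((hA n k).diff (hC n k))))
  let F : ℕ → Ω → ℝ≥0∞ := fun n ω => ∑' k, g (c k) * w n k ω
  have hF : ∀ n, Measurable (F n) := fun n =>
    Measurable.tsum fun k => (hw n k).const_mul _
  have hFsum : ∀ n ω, F n ω = ∑' x : ↥(Φ ω ∩ B),
      Set.indicator {1} 1 ((Φ ω ∩ B) ∩ κ n ⁻¹' {κ n x}).encard *
        (g (c (κ n x)) * (q : ℝ≥0∞) ^
          (count Φ (A n (κ n x) \ C n (κ n x)) ω).toNat) := fun n ω => by
    rw [← tsum_indicator_singleton_fiber (Φ ω ∩ B) (κ n) (fun k => g (c k) * (q : ℝ≥0∞) ^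
          (count Φ (A n k \ C n k) ω).toNat)]
    refine tsum_congr fun k => ?_
    simp only [w, count, C]
    rw [← Set.inter_assoc]
    ring
  have hind1 : ∀ m : ℕ∞, Set.indicator {1} (1 : ℕ∞ → ℝ≥0∞) m ≤ 1 := fun m =>
    Set.indicator_le_self' (fun _ _ => zero_le) m
  let J : ℕ → ℕ → ℝ≥0∞ := fun n k =>
    ENNReal.ofReal (Real.exp (-(lam * volume.real (C n k)))) *
      ENNReal.ofReal (Real.exp (-((1 - q) * (lam * volume.real (A n k \ C n k)))))
  -- The sum over cells weighted by area is the integral over B of a function of the cell index.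
  have hint : ∀ n, ∫⁻ ω, F n ω ∂P = lam * ∫⁻ x in B, g (c (κ n x)) * J n (κ n x) := fun n => by
    rw [lintegral_tsum fun k => ((hw n k).const_mul _).aemeasurable,
      ← lintegral_map (f := fun k => g (c k) * J n k) .of_discrete (hκm n), lintegral_countable',
      ← ENNReal.tsum_mul_left]
    refine tsum_congr fun k => ?_
    rw [lintegral_const_mul _ (hw n k), h.lintegral_indicator_count_mul_pow (hA n k) (hAb n k)
      (hC n k) (hCb n k), Measure.map_apply (hκm n) (MeasurableSet.singleton k),
      Measure.restrict_apply (hκm n (MeasurableSet.singleton k)), Set.inter_comm]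
    simp only [J, C]
    ring
  have hlimF : Tendsto (fun n => ∫⁻ ω, F n ω ∂P) atTop (𝓝 (∫⁻ ω, ∑' x : ↥(Φ ω ∩ B), g x *
      (q : ℝ≥0∞) ^ ((Φ ω ∩ ball (a x) (r x)) \ {x.1}).ncard ∂P)) := by
    -- All weights are at most 1, so the count in B dominates, and it has finite mean.
    refine tendsto_lintegral_of_dominated_convergence (fun ω => (count Φ B ω : ℝ≥0∞)) hF
      (fun n => ae_of_all _ fun ω => ?_) (h.lintegral_count_ne_top hB hBb) ?_
    · simp only [hFsum, count]
      rw [← ENNReal.tsum_set_one]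
      exact ENNReal.tsum_le_tsum fun x =>
        mul_le_one' (hind1 _) (mul_le_one' (hg1 _) (pow_le_one₀ zero_le hq'))
    · filter_upwards [h.locallyFinite] with ω hω
      simp only [hFsum]
      have : Fintype ↥(Φ ω ∩ B) := (hω B hBb).fintype
      simp only [tsum_fintype]
      refine tendsto_finsetSum _ fun x _ => ?_
      have h1 := eventually_inter_cell_eq_singleton hδ hκ (hω B hBb) x.2
      have h2 := eventually_inter_ball_diff_cell ha hr hδ hκ hω hBb x.2
      have h3 : Tendsto (fun n => g (c (κ n x))) atTop (𝓝 (g x)) :=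
        (hg.tendsto _).comp (tendsto_cell_center hδ hκ x)
      have h4 := ENNReal.Tendsto.mul_const (b := (q : ℝ≥0∞) ^
        ((Φ ω ∩ ball (a x) (r x)) \ {x.1}).ncard) h3
        (Or.inr (ne_top_of_le_ne_top ENNReal.one_ne_top (pow_le_one₀ zero_le hq')))
      refine h4.congr' ?_
      filter_upwards [h1, h2] with n hn1 hn2
      simp only [count, A, C]
      rw [hn1, hn2, Set.encard_singleton, Set.ncard_def]
      simp
  have hlimG : Tendsto (fun n => ∫⁻ ω, F n ω ∂P) atTop (𝓝 (lam * ∫⁻ x in B, g x *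
      ENNReal.ofReal (Real.exp (-((1 - q) * (lam * volume.real (ball (a x) (r x)))))))) := by
    simp only [hint]
    refine ENNReal.Tendsto.const_mul ?_ (Or.inr ENNReal.coe_ne_top)
    have hJ1 : ∀ n k, J n k ≤ 1 := fun n k => by
      have hq0 : (0 : ℝ) ≤ 1 - q := sub_nonneg.2 (by exact_mod_cast hq)
      refine mul_le_one' ?_ ?_ <;>
      · rw [ENNReal.ofReal_le_one, Real.exp_le_one_iff, neg_nonpos]
        positivity
    refine tendsto_lintegral_of_dominated_convergence (fun _ => 1)
      (fun n => (Measurable.of_discrete (f := fun k => g (c k) * J n k)).comp (hκm n))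
      (fun n => ae_of_all _ fun x => mul_le_one' (hg1 _) (hJ1 _ _))
      (by simpa using hBb.measure_lt_top.ne) (ae_of_all _ fun x => ?_)
    have h3 : Tendsto (fun n => g (c (κ n x))) atTop (𝓝 (g x)) :=
      (hg.tendsto _).comp (tendsto_cell_center hδ hκ x)
    have hv0 := tendsto_volume_real_cell hδ hκ B x
    have hv1 := tendsto_volume_real_ball_diff_cell (a := a) hr hδ hκ B x
    have h4 : Tendsto (fun n => J n (κ n x)) atTop (𝓝 (ENNReal.ofReal
        (Real.exp (-((1 - q) * (lam * volume.real (ball (a x) (r x)))))))) := by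
      have h5 := ENNReal.tendsto_ofReal ((Real.continuous_exp.tendsto _).comp
        ((hv0.const_mul (lam : ℝ)).neg.add ((hv1.const_mul (lam : ℝ)).const_mul (1 - (q : ℝ))).neg))
      simp only [mul_zero, neg_zero, zero_add] at h5
      refine h5.congr fun n => ?_
      simp only [J, A, C, Function.comp]
      rw [Real.exp_add, ENNReal.ofReal_mul (Real.exp_nonneg _)]
    exact ENNReal.Tendsto.mul h3 (Or.inr ENNReal.ofReal_ne_top) h4
      (Or.inr (ne_top_of_le_ne_top ENNReal.one_ne_top (hg1 x)))
  exact tendsto_nhds_unique hlimF hlimG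

end IsPoissonProcess

/-! ### The Gaussian integral and Fubini for independent variables. -/

open Metric in
/-- The Gaussian integral over a disk. -/
theorem lintegral_ball_exp_neg_mul_sq {A η : ℝ} (hA : 0 < A) (hη : 0 < η) :
    ∫⁻ x in ball (0 : Plane) η, ENNReal.ofReal (Real.exp (-(A * Real.pi * ‖x‖ ^ 2))) =
      ENNReal.ofReal ((1 - Real.exp (-(A * Real.pi * η ^ 2))) / A) := by
  have hcont : Continuous fun x : Plane => Real.exp (-(A * Real.pi * ‖x‖ ^ 2)) := by fun_prop
  have hint : IntegrableOn (fun x : Plane => Real.exp (-(A * Real.pi * ‖x‖ ^ 2))) (ball 0 η) :=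
    (hcont.continuousOn.integrableOn_compact (isCompact_closedBall 0 η)).mono_set
      ball_subset_closedBall
  rw [← ofReal_integral_eq_lintegral_ofReal hint (ae_of_all _ fun x => (Real.exp_nonneg _))]
  congr 1
  have h1 : ∫ x in ball (0 : Plane) η, Real.exp (-(A * Real.pi * ‖x‖ ^ 2)) =
      ∫ x : Plane, Set.indicator (Set.Iio η)
        (fun y => Real.exp (-(A * Real.pi * y ^ 2))) ‖x‖ := by
    rw [← integral_indicator measurableSet_ball]
    refine integral_congr_ae (ae_of_all _ fun x => ?_)
    simp [Set.indicator]
  -- Polar coordinates: the angular factor is dimension times unit disk area, 2π, and cancels the 2π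
  -- in `h3`.
  rw [h1, integral_fun_norm_addHaar]
  have h2 : ∫ y in Set.Ioi (0 : ℝ), y ^ (Module.finrank ℝ Plane - 1) • Set.indicator (Set.Iio η)
        (fun y => Real.exp (-(A * Real.pi * y ^ 2))) y =
      ∫ y in (0 : ℝ)..η, y * Real.exp (-(A * Real.pi * y ^ 2)) := by
    rw [intervalIntegral.integral_of_le hη.le, integral_Ioc_eq_integral_Ioo,
      ← integral_indicator measurableSet_Ioi, ← integral_indicator measurableSet_Ioo]
    refine integral_congr_ae (ae_of_all _ fun y => ?_)
    by_cases h0 : 0 < y <;> by_cases h1 : y < η <;> simp [Set.indicator, h0, h1]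
  have h3 : ∫ y in (0 : ℝ)..η, y * Real.exp (-(A * Real.pi * y ^ 2)) =
      (1 - Real.exp (-(A * Real.pi * η ^ 2))) / (2 * Real.pi * A) := by
    have hd : ∀ y ∈ Set.uIcc 0 η, HasDerivAt
        (fun y => -(Real.exp (-(A * Real.pi * y ^ 2)) / (2 * Real.pi * A)))
        (y * Real.exp (-(A * Real.pi * y ^ 2))) y := fun y _ => by
      have := ((((hasDerivAt_pow 2 y).const_mul (A * Real.pi)).neg.exp).div_const
        (2 * Real.pi * A)).neg
      refine this.congr_deriv ?_
      have := Real.pi_pos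
      field_simp
      simp
      ring
    rw [intervalIntegral.integral_eq_sub_of_hasDerivAt hd
      ((by fun_prop : Continuous fun y : ℝ => y * Real.exp (-(A * Real.pi * y ^ 2))
        ).intervalIntegrable _ _)]
    simp
    ring
  rw [h2, h3, volume_real_ball]
  have := Real.pi_pos
  simp
  field_simp

/-- Fubini for a function of two independent random variables. -/
theorem lintegral_comp_of_indepFun {Ω α β : Type*} [MeasurableSpace Ω] [MeasurableSpace α]
    [MeasurableSpace β] {P : Measure Ω} [IsProbabilityMeasure P] {X : Ω → α} {Y : Ω → β}
    (hX : Measurable X) (hY : Measurable Y) (h : IndepFun X Y P) {F : α × β → ℝ≥0∞}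
    (hF : Measurable F) :
    ∫⁻ ω, F (X ω, Y ω) ∂P = ∫⁻ ω, ∫⁻ ω', F (X ω, Y ω') ∂P ∂P := by
  have hp := h.map_prod_eq_prod_map_map hX.aemeasurable hY.aemeasurable
  have : IsProbabilityMeasure (P.map Y) := Measure.isProbabilityMeasure_map hY.aemeasurable
  rw [← lintegral_map hF (hX.prodMk hY), hp, lintegral_prod _ hF.aemeasurable,
    lintegral_map hF.lintegral_prod_right' hX]
  refine lintegral_congr fun ω => ?_
  exact lintegral_map (hF.comp measurable_prodMk_left) hY

/-! ### Void events through countably many counts. -/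

section Void

open Metric

variable {Ω : Type*}

/-- The counts of `Φ` in a countable base of balls. -/
noncomputable def baseCounts (Φ : Ω → Set Plane) (ω : Ω) (k : ℕ × ℕ) : ℕ∞ :=
  count Φ (ball (TopologicalSpace.denseSeq Plane k.1) (1 / ((k.2 : ℝ) + 1))) ω

/-- The data `(y, s, z)` for which every basic ball inside the ball of radius `s` around `y`
has count zero in `z`. -/
def voidSet : Set ((Plane × ℝ) × (ℕ × ℕ → ℕ∞)) :=
  {v | ∀ k : ℕ × ℕ, dist (TopologicalSpace.denseSeq Plane k.1) v.1.1 + 1 / ((k.2 : ℝ) + 1) ≤ v.1.2 →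
    v.2 k = 0}

theorem measurableSet_voidSet : MeasurableSet voidSet := by
  refine measurableSet_setOfPred.2 (Measurable.forall fun k => Measurable.imp ?_ ?_)
  · exact measurableSet_setOfPred.1 (measurableSet_le (by fun_prop) (by fun_prop))
  · exact measurableSet_setOfPred.1 (measurableSet_eq_fun (by fun_prop) (by fun_prop))

/-- Every point of an open ball lies in a basic ball that the triangle inequality certifies to be
inside it. Emptiness thus becomes countably many count conditions, even when centre and radius are
random. -/
theorem mem_voidSet_iff (Φ : Ω → Set Plane) (ω : Ω) (y : Plane) (s : ℝ) :
    ((y, s), baseCounts Φ ω) ∈ voidSet ↔ ∀ z ∈ Φ ω, z ∉ ball y s := by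
  constructor
  · intro h z hz hzy
    -- Half the slack: the basic radius is used once to reach z from the basic centre and once as
    -- the radius of the basic ball.
    have hpos : 0 < (s - dist z y) / 2 := by
      have := mem_ball.1 hzy
      linarith
    obtain ⟨m, hm⟩ := exists_nat_one_div_lt hpos
    obtain ⟨k, hk⟩ := (TopologicalSpace.denseRange_denseSeq Plane).exists_dist_lt z
      (by positivity : (0 : ℝ) < 1 / ((m : ℝ) + 1))
    have h1 := h (k, m) (by
      have := dist_triangle_left (TopologicalSpace.denseSeq Plane k) y z
      simp only
      linarith)
    replace h1 := Set.encard_eq_zero.1 h1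
    exact (Set.ext_iff.1 h1 z).1 ⟨hz, hk⟩
  · intro h k hk
    refine Set.encard_eq_zero.2 ?_
    refine Set.eq_empty_of_forall_notMem fun z hz => h z hz.1 (mem_ball.2 ?_)
    have h1 := mem_ball.1 hz.2
    have h2 := dist_triangle z (TopologicalSpace.denseSeq Plane k.1) y
    simp only at hk
    linarith

/-- Measurability for `sigmaOf Φ` itself is what transfers the independence of the eavesdroppers to
their base counts. -/
theorem measurable_baseCounts (Φ : Ω → Set Plane) : Measurable[sigmaOf Φ] (baseCounts Φ) := by
  refine (@measurable_pi_iff _ _ _ (sigmaOf Φ) _ _).2 fun k => ?_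
  rw [measurable_iff_comap_le]
  exact le_iSup₂_of_le (ball (TopologicalSpace.denseSeq Plane k.1) (1 / ((k.2 : ℝ) + 1)))
    measurableSet_ball le_rfl

theorem sigmaOf_le [m : MeasurableSpace Ω] {P : Measure Ω} {Φ : Ω → Set Plane} {lam : ℝ≥0}
    (h : IsPoissonProcess P Φ lam) : sigmaOf Φ ≤ m :=
  iSup₂_le fun B hB => (h.measurable_count B hB).comap_le

theorem IsPoissonProcess.measure_void [MeasurableSpace Ω] {P : Measure Ω} {Φ : Ω → Set Plane}
    {lam : ℝ≥0} (h : IsPoissonProcess P Φ lam) (y : Plane) (s : ℝ) :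
    P {ω | ∀ z ∈ Φ ω, z ∉ ball y s} =
      ENNReal.ofReal (Real.exp (-(lam * volume.real (ball y s)))) := by
  have := h.measure_count_eq (measurableSet_ball (x := y) (ε := s)) isBounded_ball 0
  simp only [pow_zero, mul_one, Nat.factorial_zero, Nat.cast_one, div_one] at this
  rw [← this]
  congr 1
  ext ω
  simp only [count, Set.mem_ofPred_eq, Nat.cast_zero, Set.encard_eq_zero,
    Set.eq_empty_iff_forall_notMem, Set.mem_inter_iff, not_and]

end Void

/-! ### Link events and averaging over the eavesdroppers. -/

namespace Network

open Metric

variable {Ω : Type*} (N : Network Ω)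

/-- The number of nodes and their positions, together with their modes. -/
abbrev NodeData : Type := (ℕ∞ × (ℕ → Plane)) × (ℕ → Bool)

/-- Positions and modes for which node `i` is present in mode `b` within range `η`, and no other
transmitter lies in its exclusion ball. -/
def clearSet (η βl : ℝ) (aL : Plane → Plane) (b : Bool) (i : ℕ) :
    Set NodeData :=
  {ξ | (((i : ℕ∞) < ξ.1.1 ∧ ξ.1.2 i ∈ ball 0 η) ∧ ξ.2 i = b) ∧
    ∀ j, (j ≠ i ∧ (j : ℕ∞) < ξ.1.1 ∧ ξ.1.2 j ∈ ball (aL (ξ.1.2 i)) (βl * ‖ξ.1.2 i‖)) →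
      ξ.2 j = false}

theorem measurableSet_clearSet (η βl : ℝ) {aL : Plane → Plane} (ha : Continuous aL) (b : Bool)
    (i : ℕ) : MeasurableSet (clearSet η βl aL b i) := by
  have hlt : ∀ j : ℕ, Measurable fun ξ : NodeData => (j : ℕ∞) < ξ.1.1 :=
    fun j => (Measurable.of_discrete (f := fun n : ℕ∞ => (j : ℕ∞) < n)).comp
      (measurable_fst.comp measurable_fst)
  have hpos : ∀ j : ℕ, Measurable fun ξ : NodeData => ξ.1.2 j :=
    fun j => by fun_prop
  have htx : ∀ (j : ℕ) (c : Bool),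
      Measurable fun ξ : NodeData => ξ.2 j = c :=
    fun j c => (Measurable.of_discrete (f := fun t : Bool => t = c)).comp
      ((measurable_pi_apply j).comp measurable_snd)
  refine measurableSet_setOfPred.2 ((((hlt i).and ?_).and (htx i b)).and
    (Measurable.forall fun j => Measurable.imp (measurable_const.and ((hlt j).and ?_)) (htx j _)))
  · exact measurableSet_setOfPred.1 (hpos i measurableSet_ball)
  · refine measurableSet_setOfPred.1 (measurableSet_lt ((hpos j).dist (ha.measurable.comp (hpos i)))
      ((hpos i).norm.const_mul _))

/-- Node `i` is present in mode `b` within range `η`, no other transmitter lies in its exclusion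
ball, and no eavesdropper lies in its secrecy ball. -/
def linkEvent (η βl βe : ℝ) (aL aE : Plane → Plane) (b : Bool) (i : ℕ) : Set Ω :=
  {ω | ((N.num ω, fun i => N.node i ω), fun i => N.tx i ω) ∈ clearSet η βl aL b i ∧
    ∀ z ∈ N.eves ω, z ∉ ball (aE (N.node i ω)) (βe * ‖N.node i ω‖)}

/-- In this form the event depends measurably on two independent variables, the node data and the
base counts. -/
theorem linkEvent_eq (η βl βe : ℝ) (aL aE : Plane → Plane) (b : Bool) (i : ℕ) :
    N.linkEvent η βl βe aL aE b i =
      {ω | ((N.num ω, fun i => N.node i ω), fun i => N.tx i ω) ∈ clearSet η βl aL b i ∧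
        ((aE (N.node i ω), βe * ‖N.node i ω‖), baseCounts N.eves ω) ∈ voidSet} := by
  simp only [linkEvent, mem_voidSet_iff]

variable {N} [MeasurableSpace Ω] {P : Measure Ω} {lamL lamE : ℝ≥0} {p : ℝ}

namespace IsAlohaModel

theorem measurable_positions (hN : N.IsAlohaModel P lamL lamE p) :
    Measurable fun ω => (N.num ω, fun i => N.node i ω) :=
  hN.measurable_num.prodMk (measurable_pi_iff.2 hN.measurable_node)

theorem measurable_data (hN : N.IsAlohaModel P lamL lamE p) :
    Measurable fun ω => ((N.num ω, fun i => N.node i ω), fun i => N.tx i ω) :=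
  hN.measurable_positions.prodMk (measurable_pi_iff.2 hN.measurable_tx)

theorem measurable_baseCounts_eves (hN : N.IsAlohaModel P lamL lamE p) :
    Measurable (baseCounts N.eves) :=
  (measurable_baseCounts N.eves).mono (sigmaOf_le hN.poisson_eves) le_rfl

theorem indepFun_data_baseCounts (hN : N.IsAlohaModel P lamL lamE p) :
    IndepFun (fun ω => ((N.num ω, fun i => N.node i ω), fun i => N.tx i ω))
      (baseCounts N.eves) P := by
  rw [IndepFun_iff_Indep]
  exact indep_of_indep_of_le_right hN.indep_eves (measurable_baseCounts N.eves).comap_le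

variable {aL aE : Plane → Plane}

theorem measurableSet_linkEvent (hN : N.IsAlohaModel P lamL lamE p) (haL : Continuous aL)
    (haE : Continuous aE) (η βl βe : ℝ) (b : Bool) (i : ℕ) :
    MeasurableSet (N.linkEvent η βl βe aL aE b i) := by
  rw [linkEvent_eq]
  have hn := hN.measurable_node i
  exact (hN.measurable_data (measurableSet_clearSet η βl haL b i)).inter
    ((((haE.measurable.comp hn).prodMk (hn.norm.const_mul βe)).prodMk
      hN.measurable_baseCounts_eves) measurableSet_voidSet)

/-- Averaging over the eavesdroppers. -/
theorem measure_linkEvent_eq_lintegral_clearSet [IsProbabilityMeasure P]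
    (hN : N.IsAlohaModel P lamL lamE p) (haL : Continuous aL)
    (haE : Continuous aE) (η βl βe : ℝ) (b : Bool) (i : ℕ) :
    P (N.linkEvent η βl βe aL aE b i) =
      ∫⁻ ω, (clearSet η βl aL b i).indicator 1
          ((N.num ω, fun i => N.node i ω), fun i => N.tx i ω) *
        ENNReal.ofReal (Real.exp (-(lamE *
          volume.real (ball (aE (N.node i ω)) (βe * ‖N.node i ω‖))))) ∂P := by
  let V : Set (NodeData × (ℕ × ℕ → ℕ∞)) :=
    {v | ((aE (v.1.1.2 i), βe * ‖v.1.1.2 i‖), v.2) ∈ voidSet}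
  have hpos : Measurable fun v : NodeData × (ℕ × ℕ → ℕ∞) => v.1.1.2 i := by
    fun_prop
  have hV : MeasurableSet V :=
    (((haE.measurable.comp hpos).prodMk (hpos.norm.const_mul βe)).prodMk measurable_snd)
      measurableSet_voidSet
  have hA := measurableSet_clearSet η βl haL b i
  have hF : Measurable fun v : NodeData × (ℕ × ℕ → ℕ∞) =>
      (clearSet η βl aL b i).indicator (1 : NodeData → ℝ≥0∞) v.1 *
        V.indicator (1 : NodeData × (ℕ × ℕ → ℕ∞) → ℝ≥0∞) v :=
    ((measurable_one.indicator hA).comp measurable_fst).mul (measurable_one.indicator hV)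
  have h1 := lintegral_comp_of_indepFun hN.measurable_data hN.measurable_baseCounts_eves
    hN.indepFun_data_baseCounts hF
  rw [← lintegral_indicator_one (hN.measurableSet_linkEvent haL haE η βl βe b i)]
  refine Eq.trans ?_ (h1.trans ?_)
  · refine lintegral_congr fun ω => ?_
    rw [linkEvent_eq]
    simp only [Set.indicator, V, Set.mem_ofPred_eq, Pi.one_apply]
    split_ifs <;> simp_all
  · refine lintegral_congr fun ω => ?_
    have hm : MeasurableSet {ω' | ((aE (N.node i ω), βe * ‖N.node i ω‖),
        baseCounts N.eves ω') ∈ voidSet} :=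
      (measurable_const.prodMk hN.measurable_baseCounts_eves) measurableSet_voidSet
    have h2 : ∀ ω', V.indicator (1 : NodeData × (ℕ × ℕ → ℕ∞) → ℝ≥0∞) (((N.num ω, fun i => N.node i ω),
        fun i => N.tx i ω), baseCounts N.eves ω') = Set.indicator {ω' | ((aE (N.node i ω),
          βe * ‖N.node i ω‖), baseCounts N.eves ω') ∈ voidSet} 1 ω' := fun ω' => rfl
    simp only [h2]
    rw [lintegral_const_mul _ (measurable_one.indicator hm), lintegral_indicator_one hm]
    simp only [mem_voidSet_iff]
    rw [hN.poisson_eves.measure_void]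

end IsAlohaModel

end Network

/-! ### Averaging over the modes, then over the positions. -/

namespace Network

open Metric

variable {Ω : Type*} {N : Network Ω} [MeasurableSpace Ω] {P : Measure Ω} {lamL lamE : ℝ≥0} {p : ℝ}

/-- The probability that a node is in mode `b`. -/
noncomputable def modeProb (p : ℝ) (b : Bool) : ℝ≥0∞ :=
  if b then ENNReal.ofReal p else ENNReal.ofReal (1 - p)

theorem modeProb_ne_top (p : ℝ) (b : Bool) : modeProb p b ≠ ∞ := by
  cases b <;> simp [modeProb]

namespace IsAlohaModel

theorem measure_tx_eq [IsProbabilityMeasure P] (hN : N.IsAlohaModel P lamL lamE p) (hp0 : 0 ≤ p)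
    (i : ℕ) (b : Bool) : P (N.tx i ⁻¹' {b}) = modeProb p b := by
  have h1 : N.tx i ⁻¹' {true} = {ω | N.tx i ω = true} := rfl
  cases b
  · have h2 : N.tx i ⁻¹' {false} = (N.tx i ⁻¹' {true})ᶜ := by
      ext ω
      simp
    rw [h2, prob_compl_eq_one_sub (hN.measurable_tx i (MeasurableSet.singleton _)), h1,
      hN.prob_tx i, modeProb, if_neg (by decide), ENNReal.ofReal_sub _ hp0, ENNReal.ofReal_one]
  · rw [h1, hN.prob_tx i, modeProb, if_pos rfl]

/-- The probability that node `i` is in mode `b` and finitely many other nodes are silent. -/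
theorem measure_tx_eq_and_silent [IsProbabilityMeasure P] (hN : N.IsAlohaModel P lamL lamE p)
    (hp0 : 0 ≤ p) {i : ℕ} (b : Bool) {J : Set ℕ} (hJ : J.Finite) (hi : i ∉ J) :
    P {ω | N.tx i ω = b ∧ ∀ j ∈ J, N.tx j ω = false} =
      modeProb p b * ((1 - p).toNNReal : ℝ≥0∞) ^ J.ncard := by
  classical
  lift J to Finset ℕ using hJ
  have hi' : i ∉ J := by simpa using hi
  have h1 := hN.indep_tx.measure_inter_preimage_eq_mul (insert i J)
    (sets := fun j => if j = i then {b} else {false}) (fun j _ => MeasurableSet.of_discrete)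
  have h2 : {ω | N.tx i ω = b ∧ ∀ j ∈ (J : Set ℕ), N.tx j ω = false} =
      ⋂ j ∈ insert i J, N.tx j ⁻¹' (if j = i then {b} else {false}) := by
    rw [Finset.set_biInter_insert, if_pos rfl]
    ext ω
    simp only [Set.mem_ofPred_eq, Set.mem_inter_iff, Set.mem_preimage, Set.mem_singleton_iff,
      Set.mem_iInter, Finset.mem_coe]
    refine and_congr_right fun _ => forall₂_congr fun j hj => ?_
    rw [if_neg (ne_of_mem_of_not_mem hj hi')]
    rfl
  rw [h2, h1, Finset.prod_insert hi', if_pos rfl, hN.measure_tx_eq hp0, Set.ncard_coe_finset]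
  congr 1
  rw [← Finset.prod_const]
  refine Finset.prod_congr rfl fun j hj => ?_
  rw [if_neg (ne_of_mem_of_not_mem hj hi'), hN.measure_tx_eq hp0]
  rfl

variable {aL aE : Plane → Plane}

/-- Averaging over the modes of the nodes, for fixed positions. -/
theorem lintegral_clearSet_eq [IsProbabilityMeasure P] (hN : N.IsAlohaModel P lamL lamE p)
    (hp0 : 0 ≤ p) (haL : Continuous aL) (η βl : ℝ) (b : Bool) (i : ℕ) {ω : Ω}
    (hinj : Set.InjOn (fun i => N.node i ω) {i : ℕ | (i : ℕ∞) < N.num ω})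
    (hfin : ∀ B, Bornology.IsBounded B → (N.legit ω ∩ B).Finite) :
    ∫⁻ ω', (clearSet η βl aL b i).indicator 1
        ((N.num ω, fun i => N.node i ω), fun i => N.tx i ω') ∂P =
      modeProb p b * Set.indicator {j : ℕ | (j : ℕ∞) < N.num ω ∧ N.node j ω ∈ ball 0 η}
        (fun j => ((1 - p).toNNReal : ℝ≥0∞) ^ ((N.legit ω ∩ ball (aL (N.node j ω))
          (βl * ‖N.node j ω‖)) \ {N.node j ω}).ncard) i := by
  have hm : MeasurableSet {ω' | ((N.num ω, fun i => N.node i ω), fun i => N.tx i ω') ∈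
      clearSet η βl aL b i} :=
    (measurable_const.prodMk (measurable_pi_iff.2 hN.measurable_tx))
      (measurableSet_clearSet η βl haL b i)
  refine (lintegral_indicator_one hm).trans ?_
  by_cases hi : (i : ℕ∞) < N.num ω ∧ N.node i ω ∈ ball 0 η
  · rw [Set.indicator_of_mem (show i ∈ {j : ℕ | (j : ℕ∞) < N.num ω ∧ N.node j ω ∈ ball 0 η} from hi)]
    -- The possible interferers as indices; without repeated nodes, they correspond bijectively to
    -- the other points of the exclusion ball.
    set J : Set ℕ := {j | j ≠ i ∧ (j : ℕ∞) < N.num ω ∧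
      N.node j ω ∈ ball (aL (N.node i ω)) (βl * ‖N.node i ω‖)} with hJdef
    have hJinj : Set.InjOn (fun j => N.node j ω) J := hinj.mono fun j hj => hj.2.1
    have himg : (fun j => N.node j ω) '' J =
        (N.legit ω ∩ ball (aL (N.node i ω)) (βl * ‖N.node i ω‖)) \ {N.node i ω} := by
      ext x
      constructor
      · rintro ⟨j, ⟨hji, hj, hjb⟩, rfl⟩
        exact ⟨⟨⟨j, hj, rfl⟩, hjb⟩, fun h => hji (hinj hj hi.1 h)⟩
      · rintro ⟨⟨⟨j, hj, rfl⟩, hjb⟩, hne⟩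
        exact ⟨j, ⟨fun h => hne (by rw [h]; rfl), hj, hjb⟩, rfl⟩
    have hJ : J.Finite := by
      refine Set.Finite.of_finite_image ?_ hJinj
      rw [himg]
      exact (hfin _ isBounded_ball).subset Set.sdiff_subset
    rw [← himg, hJinj.ncard_image, ← hN.measure_tx_eq_and_silent hp0 b hJ (fun h => h.1 rfl)]
    congr 1
    ext ω'
    simp only [clearSet, Set.mem_ofPred_eq, hi, true_and, hJdef]
  · rw [Set.indicator_of_notMem (show i ∉ {j : ℕ | (j : ℕ∞) < N.num ω ∧ N.node j ω ∈ ball 0 η}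
      from hi), mul_zero]
    convert measure_empty (μ := P)
    ext ω'
    simp only [clearSet, Set.mem_ofPred_eq, Set.mem_empty_iff_false, iff_false]
    exact fun h => hi h.1.1

/-- The expected number of nodes in mode `b` that form a secure link. -/
theorem tsum_measure_linkEvent [IsProbabilityMeasure P] (hN : N.IsAlohaModel P lamL lamE p)
    (hp0 : 0 ≤ p) (hp1 : p ≤ 1) {K : ℝ≥0} (haL : LipschitzWith K aL) (haE : Continuous aE)
    (η βl βe : ℝ) (b : Bool) :
    ∑' i, P (N.linkEvent η βl βe aL aE b i) = modeProb p b * (lamL *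
      ∫⁻ x in ball 0 η, ENNReal.ofReal (Real.exp (-(lamE *
          volume.real (ball (aE x) (βe * ‖x‖))))) *
        ENNReal.ofReal (Real.exp (-(p * (lamL * volume.real (ball (aL x) (βl * ‖x‖))))))) := by
  set g : Plane → ℝ≥0∞ := fun x =>
    ENNReal.ofReal (Real.exp (-(lamE * volume.real (ball (aE x) (βe * ‖x‖))))) with hgdef
  set q : ℝ≥0 := (1 - p).toNNReal with hqdef
  have hq : q ≤ 1 := by
    rw [hqdef, Real.toNNReal_le_one]
    linarith
  have hqp : 1 - (q : ℝ) = p := by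
    rw [hqdef, Real.coe_toNNReal _ (by linarith)]
    ring
  have hg : Continuous g := by
    simp only [hgdef, volume_real_ball]
    exact ENNReal.continuous_ofReal.comp (by fun_prop)
  have hg1 : ∀ x, g x ≤ 1 := fun x => by
    simp only [hgdef]
    rw [ENNReal.ofReal_le_one, Real.exp_le_one_iff, neg_nonpos]
    positivity
  have hF : ∀ i, Measurable fun ξ : NodeData =>
      (clearSet η βl aL b i).indicator (1 : NodeData → ℝ≥0∞) ξ * g (ξ.1.2 i) := fun i =>
    (measurable_one.indicator (measurableSet_clearSet η βl haL.continuous b i)).mul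
      (hg.measurable.comp (by fun_prop))
  have htx : Measurable fun ω i => N.tx i ω := measurable_pi_iff.2 hN.measurable_tx
  have h1 : ∀ i, P (N.linkEvent η βl βe aL aE b i) =
      ∫⁻ ω, ∫⁻ ω', (clearSet η βl aL b i).indicator (1 : NodeData → ℝ≥0∞)
        ((N.num ω, fun i => N.node i ω), fun i => N.tx i ω') * g (N.node i ω) ∂P ∂P := fun i => by
    rw [hN.measure_linkEvent_eq_lintegral_clearSet haL.continuous haE]
    exact lintegral_comp_of_indepFun hN.measurable_positions htx hN.indep_node_tx (hF i)
  have hmeas : ∀ i, Measurable fun ω => ∫⁻ ω', (clearSet η βl aL b i).indicator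
      (1 : NodeData → ℝ≥0∞) ((N.num ω, fun i => N.node i ω), fun i => N.tx i ω') *
        g (N.node i ω) ∂P := fun i =>
    Measurable.lintegral_prod_right' (f := fun ω : Ω × Ω => (clearSet η βl aL b i).indicator
      (1 : NodeData → ℝ≥0∞) ((N.num ω.1, fun i => N.node i ω.1), fun i => N.tx i ω.2) *
        g (N.node i ω.1))
      ((hF i).comp ((hN.measurable_positions.comp measurable_fst).prodMk
        (htx.comp measurable_snd)))
  have h2 : ∀ᵐ ω ∂P, ∑' i, ∫⁻ ω', (clearSet η βl aL b i).indicator (1 : NodeData → ℝ≥0∞)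
        ((N.num ω, fun i => N.node i ω), fun i => N.tx i ω') * g (N.node i ω) ∂P =
      modeProb p b * ∑' x : ↥(N.legit ω ∩ ball 0 η), g x *
        (q : ℝ≥0∞) ^ ((N.legit ω ∩ ball (aL x) (βl * ‖x.1‖)) \ {x.1}).ncard := by
    -- Injectivity turns the sum over indices into a sum over points, the form the Mecke formula
    -- takes.
    filter_upwards [hN.node_injOn, hN.poisson_legit.locallyFinite] with ω hinj hfin
    set I : Set ℕ := {j : ℕ | (j : ℕ∞) < N.num ω ∧ N.node j ω ∈ ball 0 η} with hI
    have himg : N.legit ω ∩ ball 0 η = (fun j => N.node j ω) '' I := by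
      ext x
      constructor
      · rintro ⟨⟨j, hj, rfl⟩, hjb⟩
        exact ⟨j, ⟨hj, hjb⟩, rfl⟩
      · rintro ⟨j, ⟨hj, hjb⟩, rfl⟩
        exact ⟨⟨j, hj, rfl⟩, hjb⟩
    rw [himg, tsum_image (fun x => g x * (q : ℝ≥0∞) ^
      ((N.legit ω ∩ ball (aL x) (βl * ‖x‖)) \ {x}).ncard) (hinj.mono fun j hj => hj.1),
      tsum_subtype I (fun j => g (N.node j ω) * (q : ℝ≥0∞) ^ ((N.legit ω ∩ ball (aL (N.node j ω))
        (βl * ‖N.node j ω‖)) \ {N.node j ω}).ncard), ← ENNReal.tsum_mul_left]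
    refine tsum_congr fun i => ?_
    rw [lintegral_mul_const' _ _ (ne_top_of_le_ne_top ENNReal.one_ne_top (hg1 _)),
      hN.lintegral_clearSet_eq hp0 haL.continuous η βl b i hinj hfin, ← hI, mul_assoc]
    congr 1
    by_cases hi : i ∈ I
    · rw [Set.indicator_of_mem hi, Set.indicator_of_mem hi, mul_comm]
    · rw [Set.indicator_of_notMem hi, Set.indicator_of_notMem hi, zero_mul]
  have hr : LipschitzWith (max K ‖βl‖₊) fun x : Plane => βl * ‖x‖ := by
    refine LipschitzWith.weaken ?_ (le_max_right _ _)
    have h := (lipschitzWith_smul βl).comp (lipschitzWith_one_norm (E := Plane))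
    rw [mul_one] at h
    exact h
  rw [tsum_congr h1, ← lintegral_tsum fun i => (hmeas i).aemeasurable, lintegral_congr_ae h2,
    lintegral_const_mul' _ _ (modeProb_ne_top p b),
    hN.poisson_legit.lintegral_tsum_mul_pow_ncard measurableSet_ball isBounded_ball
      (haL.weaken (le_max_left _ _)) hr hg hg1 hq, hqp]

end IsAlohaModel

end Network

/-! ### Degrees as sums over link events. -/

namespace Network

open Metric

variable {Ω : Type*} {N : Network Ω}

/-- The size of the image of a random index set under an injective enumeration. -/
theorem encard_image_node_eq_tsum (L : ℕ → Set Ω) {ω : Ω}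
    (hinj : Set.InjOn (fun i => N.node i ω) {i | ω ∈ L i}) :
    (((fun i => N.node i ω) '' {i | ω ∈ L i}).encard : ℝ≥0∞) =
      ∑' i, (L i).indicator (1 : Ω → ℝ≥0∞) ω := by
  rw [hinj.encard_image, ← ENNReal.tsum_set_one, tsum_subtype {i | ω ∈ L i} fun _ => (1 : ℝ≥0∞)]
  rfl

theorem linkEvent_subset (η βl βe : ℝ) (aL aE : Plane → Plane) (b : Bool) (ω : Ω) :
    {i | ω ∈ N.linkEvent η βl βe aL aE b i} ⊆ {i : ℕ | (i : ℕ∞) < N.num ω} :=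
  fun _ hi => hi.1.1.1.1

/-- The receiver is the origin, so exclusion balls are centred at 0 and secrecy balls at the node.
-/
theorem inDegree_eq_tsum (η βl βe : ℝ) {ω : Ω}
    (hinj : Set.InjOn (fun i => N.node i ω) {i : ℕ | (i : ℕ∞) < N.num ω}) :
    (N.inDegree η βl βe ω : ℝ≥0∞) =
      ∑' i, (N.linkEvent η βl βe (fun _ => 0) id true i).indicator (1 : Ω → ℝ≥0∞) ω := by
  rw [← encard_image_node_eq_tsum _ (hinj.mono (linkEvent_subset _ _ _ _ _ _ _)), inDegree]
  congr 2
  ext x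
  constructor
  · rintro ⟨⟨i, hi, hti, rfl⟩, -, hclose, hint, heve⟩
    rw [sub_zero] at hclose hint heve
    refine ⟨i, ⟨⟨⟨⟨hi, by simpa using hclose⟩, hti⟩, ?_⟩, heve⟩, rfl⟩
    rintro j ⟨hji, hj, hjb⟩
    by_contra htj
    exact hint _ ⟨j, hj, by simpa using htj, rfl⟩ (fun h => hji (hinj hj hi h)) hjb
  · rintro ⟨i, ⟨⟨⟨⟨hi, hib⟩, hti⟩, hclear⟩, heve⟩, rfl⟩
    refine ⟨⟨i, hi, hti, rfl⟩, Set.mem_insert _ _, by simpa using hib, ?_, ?_⟩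
    · rintro _ ⟨j, hj, htj, rfl⟩ hne hjb
      rw [sub_zero] at hjb
      have := hclear j ⟨fun h => hne (by rw [h]), hj, hjb⟩
      simp_all
    · simpa using heve

/-- The centres are exchanged. A node at 0 must be ruled out: if it transmitted, it would coincide
with the added transmitter and not count as an interferer. -/
theorem outDegree_eq_tsum (η βl βe : ℝ) {ω : Ω}
    (hinj : Set.InjOn (fun i => N.node i ω) {i : ℕ | (i : ℕ∞) < N.num ω})
    (h0 : (0 : Plane) ∉ N.legit ω) :
    (N.outDegree η βl βe ω : ℝ≥0∞) =
      ∑' i, (N.linkEvent η βl βe id (fun _ => 0) false i).indicator (1 : Ω → ℝ≥0∞) ω := by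
  rw [← encard_image_node_eq_tsum _ (hinj.mono (linkEvent_subset _ _ _ _ _ _ _)), outDegree]
  congr 2
  ext y
  constructor
  · rintro ⟨-, ⟨⟨i, hi, rfl⟩, hti⟩, hclose, hint, heve⟩
    rw [zero_sub, norm_neg] at hclose hint heve
    have hti' : N.tx i ω = false := by
      by_contra h
      exact hti ⟨i, hi, by simpa using h, rfl⟩
    refine ⟨i, ⟨⟨⟨⟨hi, by simpa using hclose⟩, hti'⟩, ?_⟩, heve⟩, rfl⟩
    rintro j ⟨hji, hj, hjb⟩
    by_contra htj
    exact hint _ (Set.mem_insert_of_mem _ ⟨j, hj, by simpa using htj, rfl⟩)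
      (fun h => h0 ⟨j, hj, h⟩) hjb
  · rintro ⟨i, ⟨⟨⟨⟨hi, hib⟩, hti⟩, hclear⟩, heve⟩, rfl⟩
    refine ⟨Set.mem_insert _ _, ⟨⟨i, hi, rfl⟩, ?_⟩, by simpa using hib, ?_, ?_⟩
    · rintro ⟨j, hj, htj, hji⟩
      have : j = i := hinj hj hi hji
      simp_all
    · rintro z hz hz0 hjb
      obtain ⟨j, hj, htj, rfl⟩ := hz.resolve_left hz0
      rw [zero_sub, norm_neg] at hjb
      have hji : j ≠ i := by
        rintro rfl
        simp_all
      have := hclear j ⟨hji, hj, hjb⟩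
      simp_all
    · simpa using heve

variable [MeasurableSpace Ω] {P : Measure Ω} {lamL lamE : ℝ≥0} {p : ℝ}

theorem IsAlohaModel.ae_zero_notMem_legit [IsProbabilityMeasure P]
    (hN : N.IsAlohaModel P lamL lamE p) : ∀ᵐ ω ∂P, (0 : Plane) ∉ N.legit ω := by
  have h1 := hN.poisson_legit.measure_count_eq (MeasurableSet.singleton (0 : Plane))
    Bornology.isBounded_singleton 0
  have h2 : volume.real ({0} : Set Plane) = 0 := by simp [measureReal_def]
  rw [h2] at h1
  have h3 : ∀ᵐ ω ∂P, count N.legit {0} ω = (0 : ℕ) := by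
    rw [ae_iff_prob_eq_one
      ((hN.poisson_legit.measurable_count _ (MeasurableSet.singleton _)).eq measurable_const)]
    simpa using h1
  filter_upwards [h3] with ω hω h
  rw [count, Nat.cast_zero, Set.encard_eq_zero] at hω
  exact (Set.ext_iff.1 hω 0).1 ⟨h, rfl⟩

/-- A degree that counts secure links has the expectation given by the Mecke formula. -/
theorem IsAlohaModel.lintegral_degree [IsProbabilityMeasure P]
    (hN : N.IsAlohaModel P lamL lamE p) (hp0 : 0 ≤ p) (hp1 : p ≤ 1) {K : ℝ≥0}
    {aL aE : Plane → Plane} (haL : LipschitzWith K aL) (haE : Continuous aE)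
    (η : ℝ) {βl βe : ℝ} (hβl : 0 ≤ βl) (hβe : 0 ≤ βe) (b : Bool) {D : Ω → ℝ≥0∞}
    (hD : ∀ᵐ ω ∂P, D ω =
      ∑' i, (N.linkEvent η βl βe aL aE b i).indicator (1 : Ω → ℝ≥0∞) ω) :
    AEMeasurable D P ∧ ∫⁻ ω, D ω ∂P = modeProb p b * (lamL * ∫⁻ x in ball (0 : Plane) η,
      ENNReal.ofReal (Real.exp (-((lamL * p * βl ^ 2 + lamE * βe ^ 2) * Real.pi * ‖x‖ ^ 2)))) := by
  have hm := hN.measurableSet_linkEvent haL.continuous haE η βl βe b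
  have hm' : ∀ i, Measurable ((N.linkEvent η βl βe aL aE b i).indicator (1 : Ω → ℝ≥0∞)) :=
    fun i => measurable_one.indicator (hm i)
  -- The degree is only almost surely equal to the measurable sum of indicators, hence a.e.
  -- measurability.
  refine ⟨⟨_, Measurable.tsum hm', hD⟩, ?_⟩
  rw [lintegral_congr_ae hD, lintegral_tsum fun i => (hm' i).aemeasurable]
  simp_rw [lintegral_indicator_one (hm _)]
  rw [hN.tsum_measure_linkEvent hp0 hp1 haL haE]
  congr 2
  refine lintegral_congr fun x => ?_
  rw [← ENNReal.ofReal_mul (Real.exp_nonneg _), ← Real.exp_add, volume_real_ball,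
    volume_real_ball, max_eq_left (by positivity), max_eq_left (by positivity)]
  congr 2
  ring

end Network

/-! ### Evaluation of the two means. -/

theorem mainTheorem2 {Ω : Type*} [MeasurableSpace Ω] (P : Measure Ω) [IsProbabilityMeasure P]
    (lamL lamE : ℝ≥0) (p η βl βe : ℝ) (hp0 : 0 ≤ p) (hp1 : p ≤ 1)
    (hη : 0 < η) (hβl : 0 < βl) (hβe : 0 < βe)
    (N : Network Ω) (hN : N.IsAlohaModel P lamL lamE p) :
    AEMeasurable (fun ω => (N.inDegree η βl βe ω : ℝ≥0∞)) P ∧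
    ∫⁻ ω, (N.inDegree η βl βe ω : ℝ≥0∞) ∂P =
      ENNReal.ofReal
        (lamL * p * (1 - Real.exp (-(lamL * p * βl ^ 2 + lamE * βe ^ 2) * Real.pi * η ^ 2)) /
          (lamL * p * βl ^ 2 + lamE * βe ^ 2)) ∧
    (p < 1 →
      AEMeasurable (fun ω => (N.outDegree η βl βe ω : ℝ≥0∞)) P ∧
      ∫⁻ ω, (N.inDegree η βl βe ω : ℝ≥0∞) ∂P =
        ENNReal.ofReal (p / (1 - p)) * ∫⁻ ω, (N.outDegree η βl βe ω : ℝ≥0∞) ∂P) := by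
  obtain ⟨hinm, hin⟩ := hN.lintegral_degree hp0 hp1 (LipschitzWith.const' (K := 1) (0 : Plane))
    continuous_id η hβl.le hβe.le true
    (hN.node_injOn.mono fun ω h => Network.inDegree_eq_tsum η βl βe h)
  obtain ⟨houtm, hout⟩ := hN.lintegral_degree hp0 hp1 LipschitzWith.id continuous_const η
    hβl.le hβe.le false ((hN.node_injOn.and hN.ae_zero_notMem_legit).mono
      fun ω h => Network.outDegree_eq_tsum η βl βe h.1 h.2)
  refine ⟨hinm, ?_, fun hp => ⟨houtm, ?_⟩⟩
  · rw [hin, Network.modeProb, if_pos rfl]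
    set A : ℝ := lamL * p * βl ^ 2 + lamE * βe ^ 2 with hA
    have hlp : 0 ≤ (lamL : ℝ) * p := by positivity
    have hA0 : 0 ≤ A := by positivity
    -- If A = 0, then λ_l p = 0 because β_l > 0; both sides vanish, which is also the stated reading
    -- of the quotient.
    rcases hA0.eq_or_lt with h0 | hpos
    · have h1 : (lamL : ℝ) * p = 0 := by
        have h2 : 0 ≤ (lamE : ℝ) * βe ^ 2 := by positivity
        have h3 : (lamL : ℝ) * p * βl ^ 2 = 0 :=
          le_antisymm (by linarith) (by positivity)
        exact (mul_eq_zero.1 h3).resolve_right (by positivity)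
      rw [← mul_assoc, ← ENNReal.ofReal_coe_nnreal, ← ENNReal.ofReal_mul hp0, mul_comm p, h1]
      simp
    · rw [lintegral_ball_exp_neg_mul_sq hpos hη, ← ENNReal.ofReal_coe_nnreal,
        ← ENNReal.ofReal_mul lamL.coe_nonneg, ← ENNReal.ofReal_mul hp0]
      congr 1
      rw [show -A * Real.pi * η ^ 2 = -(A * Real.pi * η ^ 2) by ring]
      ring
  -- The integrals agree, so only p = p/(1 - p) · (1 - p) remains.
  · rw [hin, hout, ← mul_assoc (ENNReal.ofReal (p / (1 - p))), Network.modeProb, Network.modeProb,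
      if_pos rfl, if_neg (by decide), ← ENNReal.ofReal_mul (div_nonneg hp0 (by linarith)),
      div_mul_cancel₀ _ (by linarith)]
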